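/- Let $W_k$ ($k\in\mathbb Z$) be the standard branches of the Lambert $W$ function, as defined by Corless, Gonnet, Hare, Jeffrey and Knuth: $w=W_k(z)$ is the solution of $we^w=z$ lying in the range of the $k$-th branch. (The ranges are separated by the curves $\{-\eta\cot\eta+i\eta : 2j\pi<|\eta|<(2j+1)\pi\}$, $j=0,1,2,\dots$, and the half-line $(-\infty,-1]$. They are numbered from bottom to top, the range of $W_0$ being the one that contains $0$. Each range contains its upper boundary curve and not its lower one; $(-\infty,-1]$, which separates the ranges of $W_{-1}$ and $W_1$, belongs to the range of $W_{-1}$, and the point $-1$ belongs to the ranges of both $W_0$ and $W_{-1}$.) For $\xi\in\mathbb C$ put $$B(\xi)=W_{k(\xi)}\!\left(\frac{\xi^2-2}{2e}\right),\qquad k(\xi)=\begin{cases}0&\text{if }-\pi/2<\arg\xi\le\pi/2,\\ 1&\text{if }\pi/2<\arg\xi<\pi,\\ -1&\text{otherwise,}\end{cases}$$ where $\arg\xi\in(-\pi,\pi]$ and $\arg 0=0$, and let $c_n=B^{(n)}(0)/n!$. **Theorem.** The function $B$ is analytic on the disk $|\xi|<\sqrt2$, with $B(\xi)=\sum_{n=0}^\infty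 c_n\xi^n$ there, and for every $n\ge 0$ the coefficients satisfy $$|c_n|<2\cdot(4/5)^n\qquad\text{and}\qquad |c_n|\le 1.$$ -/

import Mathlib

open Complex

/-- The boundary curves of the ranges of the branches of the Lambert function consist of points
`-η cot η + iη`. For `j : ℕ`, let `C j` be the part of this curve with `2jπ < η < (2j+1)π`.
For `j ≥ 1` it is the graph of an increasing function of the real part, with horizontal
asymptotes `Im w = 2jπ` and `Im w = (2j+1)π`. For `j = 0` it starts at the point `-1`, and is
continued to the left by the real half-line `(-∞, -1]`.
`lambertBelow j` is the set of points on or below the curve `C j`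
(for `j = 0`: on or below `(-∞, -1] ∪ C 0`). -/
def lambertBelow (j : ℕ) : Set ℂ :=
  {w | w.im ≤ 2 * j * Real.pi ∨
    (2 * j * Real.pi < w.im ∧ w.im < (2 * j + 1) * Real.pi ∧ -w.im * Real.cot w.im ≤ w.re)}

/-- The set of points strictly above the complex conjugate of the curve `C j`
(for `j = 0`: on or above the half-line `(-∞, -1]`, and strictly above the conjugate of `C 0`). -/
def lambertAbove (j : ℕ) : Set ℂ :=
  {w | -(2 * j * Real.pi) ≤ w.im ∨
    (-((2 * j + 1) * Real.pi) < w.im ∧ w.im < -(2 * j * Real.pi) ∧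
      -w.im * Real.cot w.im < w.re)}

/-- The range of the standard `k`-th branch `W_k` of the Lambert function
(Corless, Gonnet, Hare, Jeffrey, Knuth). Each range contains its upper boundary curve and not its
lower one. The real half-line `(-∞, -1]`, which separates the ranges of `W_1` and `W_{-1}`,
belongs to the range of `W_{-1}`; the point `-1` lies in the ranges of both `W_0` and `W_{-1}`. -/
def lambertRange : ℤ → Set ℂ
  | Int.ofNat 0 => {w | w ∈ lambertBelow 0 ∧ w ∈ lambertAbove 0 ∧ (w.im = 0 → -1 ≤ w.re)}
  | Int.ofNat (k + 1) => {w | w ∈ lambertBelow (k + 1) ∧ w ∉ lambertBelow k}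
  | Int.negSucc 0 => {w | (w ∈ lambertAbove 1 ∧ w ∉ lambertAbove 0) ∨ (w.im = 0 ∧ w.re ≤ -1)}
  | Int.negSucc (k + 1) => {w | w ∈ lambertAbove (k + 2) ∧ w ∉ lambertAbove (k + 1)}

/-- The standard `k`-th branch `W_k` of the Lambert function: `W_k(z)` is the solution `w` of
`w e^w = z` in the range of the branch. (There is exactly one, except that there is none
when `z = 0` and `k ≠ 0`, where the value is arbitrary.) -/
noncomputable def lambertW (k : ℤ) (z : ℂ) : ℂ :=
  Function.invFunOn (fun w : ℂ => w * exp w) (lambertRange k) z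

/-- The index of the branch of `W` used in `B(ξ)`; here `arg ξ ∈ (-π, π]` and `arg 0 = 0`. -/
noncomputable def puiseuxBranch (ξ : ℂ) : ℤ :=
  if -(Real.pi / 2) < arg ξ ∧ arg ξ ≤ Real.pi / 2 then 0
  else if Real.pi / 2 < arg ξ ∧ arg ξ < Real.pi then 1
  else -1

/-- `B(ξ) = W((ξ² - 2) / (2e))`, with the appropriate branches of `W`. -/
noncomputable def lambertB (ξ : ℂ) : ℂ :=
  lambertW (puiseuxBranch ξ) ((ξ ^ 2 - 2) / (2 * exp 1))

/-- The `n`-th Taylor coefficient `c_n` of `B` at `0`. -/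
noncomputable def puiseuxCoeff (n : ℕ) : ℂ :=
  iteratedDeriv n lambertB 0 / (n.factorial : ℂ)

/-! With `v = -B(ξ)` the defining equation becomes `v e^{1-v} = q`, where `q = 1 - ξ²/2` and `|q -
1| < 1` on the disk. The decisive fact is `re_pos_of_mul_exp_eq`: every such `v` has positive real
part. Hence `Re B < 0` on the disk, and since `B(0) = -1`, Carathéodory's inequality gives `|c_n| ≤
2/√2^n` for `n ≥ 1`. As `1/√2 < 4/5`, this yields the first bound, and for `n ≥ 2` also the second;
`c_0 = -1`, and differentiating the equation twice at `0` gives `c_1² = 1`.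

The longer task is analyticity across the rays where the branch index changes. Since `v` and `q`
have positive real part, principal logarithms apply, and the equation becomes `v - log v = 1 - log
q`. Its solution is singled out by the sign of `Im v` off the real axis and by the side of `1` on it
(`IsNegLambertB`). Such a solution exists, is unique, and the relation is closed, so `v` is
continuous in `ξ`. The inverse function theorem makes it holomorphic where `v ≠ 1`, that is for `ξ ≠
0`, and the singularity at `0` is removable. Finally, membership in the ranges of the branches is
matched with this characterization. -/

/-- The function `v - log v`, to which `w + log w` reduces under `v = -w`. -/
noncomputable def subLog (v : ℂ) : ℂ := v - log v

/-- The value of `subLog (-B(ξ))`. -/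
noncomputable def subLogTarget (ξ : ℂ) : ℂ := 1 - log (1 - ξ ^ 2 / 2)

/-! ### Solutions of `v e^{1-v} = q` lie in the right half-plane -/

theorem norm_sq_div_two_lt_one {ξ : ℂ} (hξ : ‖ξ‖ < Real.sqrt 2) : ‖ξ ^ 2 / 2‖ < 1 := by
  have h : ‖ξ‖ ^ 2 < 2 := by
    rw [← Real.sq_sqrt (show (0 : ℝ) ≤ 2 by norm_num)]
    gcongr
  rw [norm_div, norm_pow]
  norm_num
  linarith

theorem re_one_sub_sq_div_two_pos {ξ : ℂ} (hξ : ‖ξ‖ < Real.sqrt 2) :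
    0 < (1 - ξ ^ 2 / 2).re := by
  have := (re_le_norm (ξ ^ 2 / 2)).trans_lt (norm_sq_div_two_lt_one hξ)
  rw [sub_re, one_re]
  linarith

theorem one_sub_sq_div_two_im (ξ : ℂ) : (1 - ξ ^ 2 / 2).im = -(ξ.re * ξ.im) := by
  simp [pow_two]
  ring

theorem one_sub_sq_div_two_re (ξ : ℂ) : (1 - ξ ^ 2 / 2).re = 1 - (ξ.re ^ 2 - ξ.im ^ 2) / 2 := by
  simp [pow_two]

theorem abs_arg_lt_of_re_pos {v : ℂ} (h : 0 < v.re) : |arg v| < Real.pi / 2 :=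
  abs_arg_lt_pi_div_two_iff.2 (Or.inl h)

theorem mul_exp_one_sub_re (v : ℂ) : (v * exp (1 - v)).re =
    Real.exp (1 - v.re) * (v.re * Real.cos v.im + v.im * Real.sin v.im) := by
  simp [exp_re, exp_im]
  ring

theorem mul_exp_one_sub_im (v : ℂ) : (v * exp (1 - v)).im =
    Real.exp (1 - v.re) * (v.im * Real.cos v.im - v.re * Real.sin v.im) := by
  simp [exp_re, exp_im]
  ring

theorem mul_sin_le_sq (b : ℝ) : b * Real.sin b ≤ b ^ 2 := by
  have h := Real.abs_sin_le_abs (x := b)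
  calc b * Real.sin b ≤ |b * Real.sin b| := le_abs_self _
    _ = |b| * |Real.sin b| := abs_mul _ _
    _ ≤ |b| * |b| := by gcongr
    _ = b ^ 2 := by rw [← pow_two, sq_abs]

/-- Solutions of `v e^{1-v} = q` with `|q - 1| < 1` lie in the right half-plane. -/
theorem re_pos_of_mul_exp_eq {v q : ℂ} (hq : ‖q - 1‖ < 1) (h : v * exp (1 - v) = q) :
    0 < v.re := by
  -- Write `v = a + ib` with `a ≤ 0`, so `E = e^{1-a} ≥ 2`, and let `t = Re (v e^{-ib})`. The
  -- condition `|q|² < 2 Re q` gives `|v|² < t`, while `t ≤ |v|`; so `t < 1` and `|b| < 1`. Then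
  -- `cos b > 0` and `t ≤ b sin b ≤ b² ≤ |v|²`, a contradiction.
  by_contra hneg
  push Not at hneg
  set E := Real.exp (1 - v.re) with hE
  have hE2 : 2 ≤ E := by
    have := Real.add_one_le_exp (1 - v.re)
    linarith
  have hre := mul_exp_one_sub_re v
  have him := mul_exp_one_sub_im v
  rw [h, ← hE] at hre him
  set a := v.re
  set b := v.im
  have h1 : q.re ^ 2 + q.im ^ 2 < 2 * q.re := by
    have h2 : ‖q - 1‖ ^ 2 < 1 := by
      have := norm_nonneg (q - 1)
      nlinarith
    rw [Complex.sq_norm, normSq_apply] at h2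
    simp at h2
    nlinarith
  have hcs := Real.sin_sq_add_cos_sq b
  have h2 : q.re ^ 2 + q.im ^ 2 = E ^ 2 * (a ^ 2 + b ^ 2) := by
    rw [hre, him]
    linear_combination (E ^ 2 * (a ^ 2 + b ^ 2)) * hcs
  set t := a * Real.cos b + b * Real.sin b with ht
  have h3 : E * (a ^ 2 + b ^ 2) < 2 * t := by
    rw [h2, hre] at h1
    have : E * (E * (a ^ 2 + b ^ 2)) < E * (2 * t) := by nlinarith
    exact lt_of_mul_lt_mul_left this (by linarith)
  have h4 : a ^ 2 + b ^ 2 < t := by nlinarith [sq_nonneg a, sq_nonneg b]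
  have h5 : t ^ 2 ≤ a ^ 2 + b ^ 2 := by
    have : a ^ 2 + b ^ 2 - t ^ 2 = (a * Real.sin b - b * Real.cos b) ^ 2 := by
      rw [ht]
      linear_combination (-(a ^ 2 + b ^ 2)) * hcs
    nlinarith [sq_nonneg (a * Real.sin b - b * Real.cos b)]
  have h6 : t < 1 := by nlinarith [sq_nonneg a, sq_nonneg b]
  have h7 : |b| < 1 := by
    rw [← sq_lt_one_iff_abs_lt_one]
    nlinarith [sq_nonneg a]
  have h8 : 0 < Real.cos b := by
    have := Real.pi_gt_three
    apply Real.cos_pos_of_mem_Ioo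
    constructor <;> linarith [(abs_lt.1 h7).1, (abs_lt.1 h7).2]
  nlinarith [mul_sin_le_sq b, sq_nonneg a, mul_nonneg (neg_nonneg.2 hneg) h8.le]

/-! ### The logarithmic equation and its real solutions -/

theorem mul_exp_eq_of_subLog_eq {ξ v : ℂ} (hξ : ‖ξ‖ < Real.sqrt 2) (hv : 0 < v.re)
    (h : subLog v = subLogTarget ξ) : v * exp (1 - v) = 1 - ξ ^ 2 / 2 := by
  have h1 : 1 - v + log v = log (1 - ξ ^ 2 / 2) := by
    rw [subLog, subLogTarget] at h
    linear_combination -h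
  have h2 := congrArg exp h1
  rw [exp_add, exp_log (Complex.ne_zero_of_re_pos hv),
    exp_log (Complex.ne_zero_of_re_pos (re_one_sub_sq_div_two_pos hξ))] at h2
  rw [← h2, mul_comm]

theorem subLog_im (v : ℂ) : (subLog v).im = v.im - arg v := by
  simp [subLog, log_im]

theorem subLogTarget_im (ξ : ℂ) : (subLogTarget ξ).im = -arg (1 - ξ ^ 2 / 2) := by
  simp [subLogTarget, log_im]

theorem mul_exp_one_sub_le_one (x : ℝ) : x * Real.exp (1 - x) ≤ 1 := by
  have h := Real.add_one_le_exp (x - 1)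
  have h2 : Real.exp (x - 1) * Real.exp (1 - x) = 1 := by
    rw [← Real.exp_add]
    simp
  nlinarith [Real.exp_pos (1 - x)]

/-- A real `v` makes `q` real, so `ξ` is real or purely imaginary; in the latter case `q = 1 + (Im
ξ)²/2`, whereas `x e^{1-x} ≤ 1`. -/
theorem im_eq_zero_of_solution_im_eq_zero {ξ v : ℂ} (hξ : ‖ξ‖ < Real.sqrt 2) (hv : 0 < v.re)
    (h : subLog v = subLogTarget ξ) (him : v.im = 0) : ξ.im = 0 := by
  have h1 := mul_exp_eq_of_subLog_eq hξ hv h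
  have hre := mul_exp_one_sub_re v
  have hi := mul_exp_one_sub_im v
  rw [h1, him] at hre hi
  rw [one_sub_sq_div_two_im] at hi
  rw [one_sub_sq_div_two_re] at hre
  simp at hre hi
  have h2 := mul_exp_one_sub_le_one v.re
  rcases hi with hi | hi
  · rw [hi] at hre
    have : ξ.im ^ 2 ≤ 0 := by nlinarith
    nlinarith
  · exact hi

/-- With `θ = arg v = Im v`, the inequalities `sin θ < θ < tan θ` say `‖v‖ > 1` and `Re v < 1`. -/
theorem one_lt_of_im_eq_arg {v : ℂ} (hv : 0 < v.re) (hi : 0 < v.im) (h : v.im = arg v) :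
    1 < ‖v‖ * Real.exp (1 - v.re) := by
  have hlt := (abs_lt.1 (abs_arg_lt_of_re_pos hv)).2
  have h1 := Real.sin_lt hi
  have h2 := Real.lt_tan hi (by rw [h]; exact hlt)
  rw [h, sin_arg, ← h, div_lt_iff₀ (norm_pos_iff.2 (Complex.ne_zero_of_re_pos hv))] at h1
  rw [h, tan_arg, ← h, lt_div_iff₀ hv] at h2
  have h3 : 1 < ‖v‖ := by nlinarith
  have h4 : v.re < 1 := by nlinarith
  have h5 : 1 < Real.exp (1 - v.re) := Real.one_lt_exp_iff.2 (by linarith)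
  nlinarith

theorem subLog_conj {v : ℂ} (hv : 0 < v.re) :
    subLog ((starRingEnd ℂ) v) = (starRingEnd ℂ) (subLog v) := by
  have := abs_lt.1 (abs_arg_lt_of_re_pos hv)
  rw [subLog, subLog, map_sub, log_conj _ (by linarith [Real.pi_pos])]

theorem subLogTarget_conj {ξ : ℂ} (hξ : ‖ξ‖ < Real.sqrt 2) :
    subLogTarget ((starRingEnd ℂ) ξ) = (starRingEnd ℂ) (subLogTarget ξ) := by
  have := abs_lt.1 (abs_arg_lt_of_re_pos (re_one_sub_sq_div_two_pos hξ))
  rw [subLogTarget, subLogTarget, map_sub, ← log_conj _ (by linarith [Real.pi_pos])]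
  simp only [map_sub, map_one, map_div₀, map_pow, map_ofNat]

/-- Here `q` is positive and at most `1`. A solution with `Im v > 0` would have `Im v = arg v`,
hence `|q| > 1` by `one_lt_of_im_eq_arg`; conjugation handles `Im v < 0`. -/
theorem solution_im_eq_zero {ξ v : ℂ} (hξ : ‖ξ‖ < Real.sqrt 2) (hv : 0 < v.re)
    (h : subLog v = subLogTarget ξ) (him : ξ.im = 0) : v.im = 0 := by
  have key : ∀ u : ℂ, 0 < u.re → subLog u = subLogTarget ξ → ¬ 0 < u.im := by
    intro u hu hu' hpos
    have h1 := mul_exp_eq_of_subLog_eq hξ hu hu'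
    have h0 := re_one_sub_sq_div_two_pos hξ
    have hreal : 1 - ξ ^ 2 / 2 = (((1 - ξ ^ 2 / 2).re : ℝ) : ℂ) := by
      apply Complex.ext
      · simp
      · rw [one_sub_sq_div_two_im, him]
        simp
    have harg : arg (1 - ξ ^ 2 / 2) = 0 := by
      rw [hreal, arg_ofReal_of_nonneg h0.le]
    have h2 := congrArg Complex.im hu'
    rw [subLog_im, subLogTarget_im, harg] at h2
    have h3 := one_lt_of_im_eq_arg hu hpos (by linarith)
    have h4 := congrArg norm h1
    rw [norm_mul, norm_exp, hreal, norm_real, Real.norm_of_nonneg h0.le,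
      one_sub_sq_div_two_re, him] at h4
    simp at h4
    nlinarith [sq_nonneg ξ.re]
  rcases lt_trichotomy v.im 0 with h1 | h1 | h1
  · exfalso
    refine key ((starRingEnd ℂ) v) (by simpa using hv) ?_ (by simpa using h1)
    rw [subLog_conj hv, h, ← subLogTarget_conj hξ, conj_eq_iff_im.2 him]
  · exact h1
  · exact absurd h1 (key v hv h)

theorem arg_lt_im {v : ℂ} (hv : 1 ≤ v.re) (hi : 0 < v.im) : arg v < v.im := by
  have hv0 : 0 < v.re := by linarith
  have h1 : 0 < arg v := lt_of_le_of_ne (arg_nonneg_iff.2 hi.le) fun h0 => by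
    have := (arg_eq_zero_iff.1 h0.symm).2
    linarith
  have h2 := Real.lt_tan h1 (abs_lt.1 (abs_arg_lt_of_re_pos hv0)).2
  rw [tan_arg, lt_div_iff₀ hv0] at h2
  nlinarith

theorem im_lt_arg {v : ℂ} (hv : 0 < v.re) (hi : 0 < v.im) (hi2 : v.im < Real.pi / 2)
    (hc : v.re < Real.cos v.im) : v.im < arg v := by
  by_contra hle
  push Not at hle
  have h1 : 0 ≤ arg v := arg_nonneg_iff.2 hi.le
  have h2 : Real.tan (arg v) ≤ Real.tan v.im :=
    Real.strictMonoOn_tan.monotoneOn ⟨by linarith [Real.pi_pos], by linarith⟩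
      ⟨by linarith [Real.pi_pos], hi2⟩ hle
  rw [tan_arg, Real.tan_eq_sin_div_cos, div_le_div_iff₀ hv (by linarith)] at h2
  have := Real.sin_lt hi
  nlinarith

/-! ### Uniqueness of the solution -/

theorem hasStrictDerivAt_subLog {v : ℂ} (hv : v ∈ slitPlane) :
    HasStrictDerivAt subLog (1 - v⁻¹) v :=
  (hasStrictDerivAt_id v).sub (hasStrictDerivAt_log hv)

/-- The Noshiro–Warschawski argument: the derivative `1 - 1/v` has positive imaginary part on the
convex upper half-plane, so along the segment from `a` to `b = a + d` the imaginary part of `subLog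
· conj d` strictly increases. -/
theorem subLog_injOn_im_pos : Set.InjOn subLog {v | 0 < v.im} := by
  intro a ha b hb hab
  by_contra hne
  simp only [Set.mem_ofPred_eq] at ha hb
  set d := b - a with hd
  have hd0 : d ≠ 0 := sub_ne_zero.2 (Ne.symm hne)
  have hline : ∀ s ∈ Set.Icc (0 : ℝ) 1, 0 < (a + s * d).im := by
    intro s hs
    have : (a + s * d).im = (1 - s) * a.im + s * b.im := by
      simp [hd]
      ring
    rw [this]
    rcases eq_or_lt_of_le hs.1 with h0 | h0
    · rw [← h0]
      linarith
    · nlinarith [mul_nonneg (sub_nonneg.2 hs.2) ha.le, mul_pos h0 hb]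
  have hder : ∀ s ∈ Set.Icc (0 : ℝ) 1,
      HasDerivAt (fun s : ℝ => (subLog (a + s * d) * (starRingEnd ℂ) d).im)
        ((1 - (a + s * d)⁻¹) * d * (starRingEnd ℂ) d).im s := by
    intro s hs
    have h1 : HasDerivAt (fun s : ℂ => a + s * d) d (s : ℂ) := by
      simpa using ((hasDerivAt_id (s : ℂ)).mul_const d).const_add a
    have h2 := (hasStrictDerivAt_subLog (v := a + s * d)
      (Or.inr (hline s hs).ne')).hasDerivAt.comp (s : ℂ) h1
    have h3 := (h2.mul_const ((starRingEnd ℂ) d)).comp_ofReal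
    exact imCLM.hasFDerivAt.comp_hasDerivAt s h3
  have hmono : StrictMonoOn (fun s : ℝ => (subLog (a + s * d) * (starRingEnd ℂ) d).im)
      (Set.Icc 0 1) := by
    apply strictMonoOn_of_deriv_pos (convex_Icc 0 1)
    · exact fun s hs => (hder s hs).continuousAt.continuousWithinAt
    · intro s hs
      have hs' := interior_subset hs
      rw [(hder s hs').deriv, mul_assoc, mul_conj, im_mul_ofReal]
      apply mul_pos _ (normSq_pos.2 hd0)
      have h0 := hline s hs'
      rw [sub_im, one_im, inv_im, zero_sub, ← neg_div, neg_neg]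
      exact div_pos h0 (normSq_pos.2 fun h => by rw [h] at h0; simp at h0)
  have h01 := hmono (Set.left_mem_Icc.2 zero_le_one) (Set.right_mem_Icc.2 zero_le_one) one_pos
  simp [hd, hab] at h01

/-- `v = -B(ξ)`, characterized without branches of the Lambert function. -/
structure IsNegLambertB (ξ v : ℂ) : Prop where
  re_pos : 0 < v.re
  eq : subLog v = subLogTarget ξ
  im_neg : 0 < ξ.im → v.im < 0
  im_pos : ξ.im < 0 → 0 < v.im
  le_one : ξ.im = 0 → 0 ≤ ξ.re → v.re ≤ 1
  one_le : ξ.im = 0 → ξ.re < 0 → 1 ≤ v.re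

theorem strictMonoOn_sub_log : StrictMonoOn (fun x : ℝ => x - Real.log x) (Set.Ici 1) := by
  intro a ha b hb hab
  have ha0 : 0 < a := lt_of_lt_of_le one_pos ha
  have hb0 : 0 < b := ha0.trans hab
  have ha' : (1 : ℝ) ≤ a := ha
  have h1 := Real.log_lt_sub_one_of_pos (show 0 < b / a by positivity)
    (by rw [Ne, div_eq_one_iff_eq (by positivity)]; exact hab.ne')
  rw [Real.log_div (by positivity) (by positivity), div_sub_one (by positivity),
    lt_div_iff₀ (by positivity)] at h1
  have h2 : 0 < Real.log b - Real.log a := sub_pos.2 (Real.log_lt_log (by positivity) hab)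
  show a - Real.log a < b - Real.log b
  nlinarith

theorem strictAntiOn_sub_log : StrictAntiOn (fun x : ℝ => x - Real.log x) (Set.Ioc 0 1) := by
  intro a ha b hb hab
  have h1 := Real.log_lt_sub_one_of_pos (div_pos ha.1 hb.1)
    (by rw [Ne, div_eq_one_iff_eq hb.1.ne']; exact hab.ne)
  rw [Real.log_div ha.1.ne' hb.1.ne', div_sub_one hb.1.ne', lt_div_iff₀ hb.1] at h1
  have h2 : Real.log a - Real.log b < 0 := sub_neg.2 (Real.log_lt_log ha.1 hab)
  show b - Real.log b < a - Real.log a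
  nlinarith [hb.2]

theorem subLog_re_of_im_eq_zero {v : ℂ} (hi : v.im = 0) :
    (subLog v).re = v.re - Real.log v.re := by
  have : v = (v.re : ℂ) := Complex.ext rfl (by simp [hi])
  rw [subLog, this, sub_re, log_ofReal_re]
  simp

theorem IsNegLambertB.unique {ξ v w : ℂ} (hξ : ‖ξ‖ < Real.sqrt 2) (hv : IsNegLambertB ξ v)
    (hw : IsNegLambertB ξ w) : v = w := by
  have h : subLog v = subLog w := hv.eq.trans hw.eq.symm
  rcases lt_trichotomy ξ.im 0 with h1 | h1 | h1
  · exact subLog_injOn_im_pos (hv.im_pos h1) (hw.im_pos h1) h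
  · have hvi := solution_im_eq_zero hξ hv.re_pos hv.eq h1
    have hwi := solution_im_eq_zero hξ hw.re_pos hw.eq h1
    have hre := congrArg re h
    rw [subLog_re_of_im_eq_zero hvi, subLog_re_of_im_eq_zero hwi] at hre
    apply Complex.ext _ (hvi.trans hwi.symm)
    rcases le_or_gt 0 ξ.re with h2 | h2
    · exact strictAntiOn_sub_log.injOn ⟨hv.re_pos, hv.le_one h1 h2⟩
        ⟨hw.re_pos, hw.le_one h1 h2⟩ hre
    · exact strictMonoOn_sub_log.injOn (hv.one_le h1 h2) (hw.one_le h1 h2) hre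
  · have h2 := subLog_injOn_im_pos (x₁ := (starRingEnd ℂ) v) (x₂ := (starRingEnd ℂ) w)
      (by simpa using hv.im_neg h1) (by simpa using hw.im_neg h1)
      (by rw [subLog_conj hv.re_pos, subLog_conj hw.re_pos, h])
    exact (starRingEnd ℂ).injective h2

theorem isNegLambertB_zero_one : IsNegLambertB 0 1 := by
  constructor <;> simp [subLog, subLogTarget]

theorem eq_one_of_subLog_eq_one {v : ℂ} (hv : 0 < v.re) (h : subLog v = 1) : v = 1 := by
  have h0 : ‖(0 : ℂ)‖ < Real.sqrt 2 := by simp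
  have h' : subLog v = subLogTarget 0 := by simpa [subLogTarget] using h
  have hi := solution_im_eq_zero h0 hv h' rfl
  have hre := congrArg re h
  rw [subLog_re_of_im_eq_zero hi, one_re] at hre
  apply Complex.ext _ (by simpa using hi)
  by_contra hne
  have := Real.log_lt_sub_one_of_pos hv hne
  linarith

theorem im_subLog_neg_of_im_neg {v : ℂ} (hv : 1 ≤ v.re) (hi : v.im < 0) : (subLog v).im < 0 := by
  have hv0 : 0 < v.re := by linarith
  have h := arg_lt_im (v := (starRingEnd ℂ) v) (by simpa using hv) (by simpa using hi)
  have h2 := congrArg im (subLog_conj hv0)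
  rw [subLog_im, conj_im, conj_im] at h2
  rw [conj_im] at h
  linarith

/-! ### Closedness of the relation -/

open Filter Topology in
/-- The relation `IsNegLambertB` is closed over the disk. -/
theorem IsNegLambertB.of_tendsto {ι : Type*} {F : Filter ι} [NeBot F] {x v : ι → ℂ} {ξ w : ℂ}
    (hξ : ‖ξ‖ < Real.sqrt 2) (hx : Tendsto x F (𝓝 ξ)) (hv : Tendsto v F (𝓝 w))
    (hw : 0 < w.re) (heq : subLog w = subLogTarget ξ)
    (hxn : ∀ᶠ i in F, ‖x i‖ < Real.sqrt 2) (h : ∀ᶠ i in F, IsNegLambertB (x i) (v i)) :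
    IsNegLambertB ξ w := by
  have hxre := (continuous_re.tendsto ξ).comp hx
  have hxim := (continuous_im.tendsto ξ).comp hx
  have hvre := (continuous_re.tendsto w).comp hv
  have hvim := (continuous_im.tendsto w).comp hv
  -- the sign of the imaginary part of the target in terms of the quadrant
  have hpos : ∀ x : ℂ, ‖x‖ < Real.sqrt 2 → 0 < x.re * x.im → 0 < (subLogTarget x).im := by
    intro x _ h1
    rw [subLogTarget_im, neg_pos, arg_neg_iff, one_sub_sq_div_two_im]
    linarith
  have hneg : ∀ x : ℂ, ‖x‖ < Real.sqrt 2 → x.re * x.im < 0 → (subLogTarget x).im < 0 := by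
    intro x hx h1
    have := re_one_sub_sq_div_two_pos hx
    rw [subLogTarget_im, neg_lt_zero]
    apply lt_of_le_of_ne
    · rw [arg_nonneg_iff, one_sub_sq_div_two_im]
      linarith
    · intro h0
      have := (arg_eq_zero_iff.1 h0.symm).2
      rw [one_sub_sq_div_two_im] at this
      linarith
  refine ⟨hw, heq, fun h1 => ?_, fun h1 => ?_, fun h1 h2 => ?_, fun h1 h2 => ?_⟩
  · refine lt_of_le_of_ne (le_of_tendsto hvim ?_) fun h0 =>
      h1.ne' (im_eq_zero_of_solution_im_eq_zero hξ hw heq h0)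
    filter_upwards [h, hxim.eventually (lt_mem_nhds h1)] with i hi hi2
    exact (hi.im_neg hi2).le
  · refine lt_of_le_of_ne (ge_of_tendsto hvim ?_) fun h0 =>
      h1.ne (im_eq_zero_of_solution_im_eq_zero hξ hw heq h0.symm)
    filter_upwards [h, hxim.eventually (gt_mem_nhds h1)] with i hi hi2
    exact (hi.im_pos hi2).le
  · rcases h2.eq_or_lt with h0 | h0
    · have : ξ = 0 := Complex.ext h0.symm h1
      rw [eq_one_of_subLog_eq_one hw (by rw [heq, this]; simp [subLogTarget]), one_re]
    · by_contra hlt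
      push Not at hlt
      obtain ⟨i, hi, hxi, hi1, hi2⟩ := (h.and (hxn.and
        ((hxre.eventually (lt_mem_nhds h0)).and (hvre.eventually (lt_mem_nhds hlt))))).exists
      simp only [Function.comp_apply] at hi1 hi2
      have him := congrArg im hi.eq
      -- Off the axis, `Re v > 1` forces `Im (subLog v)` to have the sign of `Im v`, but the target
      -- has the opposite sign when `Re ξ > 0`.
      rcases lt_trichotomy (x i).im 0 with h3 | h3 | h3
      · have h4 := hneg _ hxi (mul_neg_of_pos_of_neg hi1 h3)
        have h5 := arg_lt_im hi2.le (hi.im_pos h3)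
        rw [subLog_im] at him
        linarith
      · linarith [hi.le_one h3 hi1.le]
      · have h4 := hpos _ hxi (mul_pos hi1 h3)
        have h5 := im_subLog_neg_of_im_neg hi2.le (hi.im_neg h3)
        linarith
  · by_contra hlt
    push Not at hlt
    have hw0 := solution_im_eq_zero hξ hw heq h1
    have hcos := (Real.continuous_cos.tendsto _).comp hvim
    -- Near a real `w < 1` the open condition `Re v < cos (Im v)` persists; there `im_lt_arg`
    -- reverses the sign of `Im v - arg v`.
    have hcos' : w.re < Real.cos w.im := by rwa [hw0, Real.cos_zero]
    have habs := (continuous_abs.tendsto _).comp hvim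
    have habs' : |w.im| < Real.pi / 2 := by simpa [hw0] using Real.pi_pos
    obtain ⟨i, hi, hxi, hi1, hi2, hi3⟩ := (h.and (hxn.and
      ((hxre.eventually (gt_mem_nhds h2)).and ((hvre.eventually_lt hcos hcos').and
        (habs.eventually (gt_mem_nhds habs')))))).exists
    simp only [Function.comp_apply] at hi1 hi2 hi3
    have him := congrArg im hi.eq
    rcases lt_trichotomy (x i).im 0 with h3 | h3 | h3
    · have h4 := hpos _ hxi (mul_pos_of_neg_of_neg hi1 h3)
      have h5 := im_lt_arg hi.re_pos (hi.im_pos h3) (abs_lt.1 hi3).2 hi2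
      rw [subLog_im] at him
      linarith
    · have h4 := hi.one_le h3 hi1
      linarith [Real.cos_le_one (v i).im]
    · have h4 := hneg _ hxi (mul_neg_of_neg_of_pos hi1 h3)
      have h5 := im_lt_arg (v := (starRingEnd ℂ) (v i)) (by simpa using hi.re_pos)
        (by simpa using hi.im_neg h3) (by simpa using by linarith [(abs_lt.1 hi3).1])
        (by simpa using hi2)
      have h6 := congrArg im (subLog_conj hi.re_pos)
      rw [subLog_im, conj_im, conj_im] at h6
      rw [conj_im] at h5
      linarith

/-! ### Compactness and existence of solutions -/

theorem log_le_half {x : ℝ} (hx : 0 < x) : Real.log x ≤ x / 2 := by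
  have h1 := Real.log_le_sub_one_of_pos (half_pos hx)
  rw [Real.log_div hx.ne' two_ne_zero] at h1
  linarith [Real.log_two_lt_d9]

/-- Solutions stay bounded while the target does, which supplies the compactness for limits along
ultrafilters. -/
theorem norm_le_of_subLog_eq {v t : ℂ} (hv : 0 < v.re) (h : subLog v = t) :
    ‖v‖ ≤ 4 * ‖t‖ + 4 := by
  have h1 : v.re - Real.log ‖v‖ = t.re := by rw [← h, subLog, sub_re, log_re]
  have h2 : v.im - arg v = t.im := by rw [← h, subLog_im]
  have h3 := abs_lt.1 (abs_arg_lt_of_re_pos hv)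
  have h4 := log_le_half (norm_pos_iff.2 (Complex.ne_zero_of_re_pos hv))
  have h5 := norm_le_abs_re_add_abs_im v
  have h6 := abs_le.1 (abs_im_le_norm t)
  have h7 := re_le_norm t
  have h8 : |v.im| ≤ ‖t‖ + 2 := by
    rw [abs_le]
    constructor <;> linarith [Real.pi_lt_four]
  rw [abs_of_pos hv] at h5
  linarith

theorem continuousAt_subLogTarget {ξ : ℂ} (hξ : ‖ξ‖ < Real.sqrt 2) :
    ContinuousAt subLogTarget ξ := by
  have h : 1 - ξ ^ 2 / 2 ∈ slitPlane := Or.inl (re_one_sub_sq_div_two_pos hξ)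
  exact continuousAt_const.sub (ContinuousAt.clog (by fun_prop) h)

open Filter Topology in
theorem exists_ultrafilter_limit_of_subLog_eq {ι : Type*} (U : Ultrafilter ι) {x v : ι → ℂ} {ξ : ℂ}
    (hξ : ‖ξ‖ < Real.sqrt 2) (hx : Tendsto x U (𝓝 ξ))
    (h : ∀ᶠ i in U, 0 < (v i).re ∧ subLog (v i) = subLogTarget (x i)) :
    ∃ w, Tendsto v U (𝓝 w) ∧ 0 < w.re ∧ subLog w = subLogTarget ξ := by
  have ht : Tendsto (fun i => subLogTarget (x i)) U (𝓝 (subLogTarget ξ)) :=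
    (continuousAt_subLogTarget hξ).tendsto.comp hx
  set C := ‖subLogTarget ξ‖ + 1
  have hC : ∀ᶠ i in U, ‖subLogTarget (x i)‖ < C :=
    ht.norm.eventually (gt_mem_nhds (lt_add_one _))
  have hball : ∀ᶠ i in U, v i ∈ Metric.closedBall (0 : ℂ) (4 * C + 4) := by
    filter_upwards [h, hC] with i hi hi2
    rw [mem_closedBall_zero_iff]
    linarith [norm_le_of_subLog_eq hi.1 hi.2]
  obtain ⟨w, -, hw⟩ := (isCompact_closedBall (0 : ℂ) (4 * C + 4)).ultrafilter_le_nhds'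
    (U.map v) hball
  have hw' : Tendsto v U (𝓝 w) := hw
  have hnorm : ∀ᶠ i in U, ‖x i‖ < Real.sqrt 2 := hx.norm.eventually (gt_mem_nhds hξ)
  -- The limit is only known to have `Re w ≥ 0`, where `log` may fail to be continuous. The
  -- exponential form passes to the limit unconditionally and gives back `Re w > 0`.
  have heq : w * exp (1 - w) = 1 - ξ ^ 2 / 2 := by
    have h1 : Tendsto (fun i => v i * exp (1 - v i)) U (𝓝 (w * exp (1 - w))) :=
      ((by fun_prop : Continuous fun w : ℂ => w * exp (1 - w)).tendsto w).comp hw'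
    have h2 : Tendsto (fun i => 1 - x i ^ 2 / 2) U (𝓝 (1 - ξ ^ 2 / 2)) :=
      ((by fun_prop : Continuous fun ξ : ℂ => 1 - ξ ^ 2 / 2).tendsto ξ).comp hx
    refine tendsto_nhds_unique_of_eventuallyEq h1 h2 ?_
    filter_upwards [h, hnorm] with i hi hi2
    exact mul_exp_eq_of_subLog_eq hi2 hi.1 hi.2
  have hre : 0 < w.re := re_pos_of_mul_exp_eq
    (by simpa using norm_sq_div_two_lt_one hξ) heq
  refine ⟨w, hw', hre, ?_⟩
  have h3 : Tendsto (fun i => subLog (v i)) U (𝓝 (subLog w)) :=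
    (hasStrictDerivAt_subLog (Or.inl hre)).hasDerivAt.continuousAt.tendsto.comp hw'
  refine tendsto_nhds_unique_of_eventuallyEq h3 ht ?_
  filter_upwards [h] with i hi using hi.2

/-- An explicit solution of `subLog v = subLogTarget ξ` off the real axis. -/
theorem exists_solution_im_pos : ∃ ξ v : ℂ, ‖ξ‖ < Real.sqrt 2 ∧ ξ.im < 0 ∧ 0 < v.re ∧ 0 < v.im ∧
    subLog v = subLogTarget ξ := by
  have hpi := Real.pi_pos
  have h2 : (0 : ℝ) < Real.sqrt 2 := by positivity
  have h22 : Real.sqrt 2 * Real.sqrt 2 = 2 := Real.mul_self_sqrt (by norm_num)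
  set r : ℝ := Real.pi / 4 * Real.sqrt 2 with hr
  have hr0 : 0 < r := by positivity
  -- The choice `v = (π/4)(1 + i)` has `Im v = arg v`, so `q` is real; it lies in `(1, 2)`, and `ξ`
  -- is then purely imaginary.
  set v : ℂ := r * exp ((Real.pi / 4 : ℝ) * I) with hv
  have hre : v.re = Real.pi / 4 := by
    rw [hv, re_ofReal_mul, exp_ofReal_mul_I_re, Real.cos_pi_div_four, hr]
    linear_combination (Real.pi / 8) * h22
  have him : v.im = Real.pi / 4 := by
    rw [hv, im_ofReal_mul, exp_ofReal_mul_I_im, Real.sin_pi_div_four, hr]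
    linear_combination (Real.pi / 8) * h22
  have hlog : log v = Real.log r + (Real.pi / 4 : ℝ) * I := by
    rw [hv, log_ofReal_mul hr0 (exp_ne_zero _), log_exp]
    · simp; linarith
    · simp; linarith
  have harg : arg v = Real.pi / 4 := by
    rw [← log_im, hlog]
    simp
  have hnorm : ‖v‖ = r := by
    rw [hv, norm_mul, norm_exp_ofReal_mul_I, norm_real, Real.norm_of_nonneg hr0.le, mul_one]
  set q : ℝ := r * Real.exp (1 - Real.pi / 4) with hq
  have hq1 : 1 < q := by
    have := one_lt_of_im_eq_arg (v := v) (by rw [hre]; positivity) (by rw [him]; positivity)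
      (by rw [him, harg])
    rwa [hnorm, hre] at this
  have hq2 : q < 2 := by
    have h3 := mul_exp_one_sub_le_one (Real.pi / 4)
    have h4 : Real.sqrt 2 < 2 := by nlinarith
    have h5 : q = Real.sqrt 2 * (Real.pi / 4 * Real.exp (1 - Real.pi / 4)) := by
      rw [hq, hr]
      ring
    rw [h5]
    nlinarith
  have hs0 : 0 < 2 * (q - 1) := by linarith
  refine ⟨-(Real.sqrt (2 * (q - 1)) * I), v, ?_, ?_, ?_, ?_, ?_⟩
  · rw [norm_neg, norm_mul, norm_I, mul_one, norm_real, Real.norm_of_nonneg (Real.sqrt_nonneg _)]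
    exact Real.sqrt_lt_sqrt hs0.le (by linarith)
  · simpa using hs0
  · rw [hre]
    positivity
  · rw [him]
    positivity
  · have h3 : 1 - (-(Real.sqrt (2 * (q - 1)) * I)) ^ 2 / 2 = (q : ℂ) := by
      rw [neg_sq, mul_pow, I_sq, ← ofReal_pow, Real.sq_sqrt hs0.le]
      push_cast
      ring
    have h4 : v = (Real.pi / 4 : ℝ) + (Real.pi / 4 : ℝ) * I := by
      apply Complex.ext <;> simp [hre, him]
    rw [subLog, subLogTarget, h3, hlog, ← ofReal_log (by linarith), hq,
      Real.log_mul hr0.ne' (Real.exp_ne_zero _), Real.log_exp, h4]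
    push_cast
    ring

open Filter Topology in
-- The set of solvable `ξ` is nonempty, open (inverse function theorem, as `v ≠ 1`) and relatively
-- closed in the lower half-disk, which is convex and hence connected.
theorem exists_solution_of_im_neg {ξ : ℂ} (hξ : ‖ξ‖ < Real.sqrt 2) (hi : ξ.im < 0) :
    ∃ v : ℂ, 0 < v.re ∧ 0 < v.im ∧ subLog v = subLogTarget ξ := by
  set s : Set ℂ := Metric.ball 0 (Real.sqrt 2) ∩ {z | z.im < 0}
  set u : Set ℂ := {ξ | ξ ∈ s ∧ ∃ v : ℂ, 0 < v.re ∧ 0 < v.im ∧ subLog v = subLogTarget ξ}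
  have hs : IsOpen s := Metric.isOpen_ball.inter (isOpen_lt continuous_im continuous_const)
  have hconv : Convex ℝ s := (convex_ball _ _).inter (convex_halfSpace_im_lt 0)
  have hu : IsOpen u := by
    rw [isOpen_iff_mem_nhds]
    rintro x ⟨hxs, v, hv, hv', hvx⟩
    have hx : ‖x‖ < Real.sqrt 2 := mem_ball_zero_iff.1 hxs.1
    have hder : (1 - v⁻¹ : ℂ) ≠ 0 := by
      intro h0
      have h1 : v = 1 := by
        rw [sub_eq_zero, eq_comm, inv_eq_one] at h0
        exact h0
      rw [h1] at hv'
      simp at hv'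
    have hQ : {v : ℂ | 0 < v.re ∧ 0 < v.im} ∈ 𝓝 v :=
      ((isOpen_lt continuous_const continuous_re).inter
        (isOpen_lt continuous_const continuous_im)).mem_nhds ⟨hv, hv'⟩
    have himg := image_mem_map (m := subLog) hQ
    rw [(hasStrictDerivAt_subLog (Or.inl hv)).map_nhds_eq hder, hvx] at himg
    filter_upwards [hs.mem_nhds hxs, continuousAt_subLogTarget hx himg] with y hy hy2
    obtain ⟨z, hz, hz2⟩ := hy2
    exact ⟨hy, z, hz.1, hz.2, hz2⟩
  have hne : (s ∩ u).Nonempty := by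
    obtain ⟨x, v, hx, hxi, hv, hv', h⟩ := exists_solution_im_pos
    exact ⟨x, ⟨mem_ball_zero_iff.2 hx, hxi⟩, ⟨mem_ball_zero_iff.2 hx, hxi⟩, v, hv, hv', h⟩
  have hclosed : closure u ∩ s ⊆ u := by
    rintro x ⟨hxu, hxs⟩
    have hx : ‖x‖ < Real.sqrt 2 := mem_ball_zero_iff.1 hxs.1
    obtain ⟨U, hU, hUx⟩ := mem_closure_iff_ultrafilter.1 hxu
    choose! v hv using fun y (hy : y ∈ u) => hy.2
    have hev : ∀ᶠ y in (U : Filter ℂ), y ∈ u := hU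
    obtain ⟨w, hw, hw1, hw2⟩ := exists_ultrafilter_limit_of_subLog_eq U (x := id) (v := v) hx hUx
      (by filter_upwards [hev] with y hy using ⟨(hv y hy).1, (hv y hy).2.2⟩)
    refine ⟨hxs, w, hw1, lt_of_le_of_ne ?_ fun h0 => ?_, hw2⟩
    · refine ge_of_tendsto ((continuous_im.tendsto w).comp hw) ?_
      filter_upwards [hev] with y hy using (hv y hy).2.1.le
    · exact (show x.im < 0 from hxs.2).ne (im_eq_zero_of_solution_im_eq_zero hx hw1 hw2 h0.symm)
  exact (hconv.isPreconnected.subset_of_closure_inter_subset hu hne hclosed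
    ⟨mem_ball_zero_iff.2 hξ, hi⟩).2

theorem exists_real_solution {p : ℝ} (hp : 1 ≤ p) :
    (∃ x : ℝ, 0 < x ∧ x ≤ 1 ∧ x - Real.log x = p) ∧ ∃ x : ℝ, 1 ≤ x ∧ x - Real.log x = p := by
  have hcont : ContinuousOn (fun x : ℝ => x - Real.log x) {0}ᶜ :=
    continuousOn_id.sub Real.continuousOn_log
  constructor
  · have hle : Real.exp (-p) ≤ 1 := Real.exp_le_one_iff.2 (by linarith)
    have h := intermediate_value_Icc' hle (hcont.mono fun x hx =>
      (lt_of_lt_of_le (Real.exp_pos _) hx.1).ne')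
    obtain ⟨x, hx, hxp⟩ := h ⟨by simpa using hp, by simpa using (Real.exp_pos _).le⟩
    exact ⟨x, lt_of_lt_of_le (Real.exp_pos _) hx.1, hx.2, hxp⟩
  -- The endpoint `2p` works because `log (2p) ≤ p`.
  · have h := intermediate_value_Icc (show 1 ≤ 2 * p by linarith) (hcont.mono fun x hx =>
      (lt_of_lt_of_le one_pos hx.1).ne')
    have := log_le_half (show 0 < 2 * p by linarith)
    obtain ⟨x, hx, hxp⟩ := h ⟨by simpa using hp, by show p ≤ 2 * p - Real.log (2 * p); linarith⟩
    exact ⟨x, hx.1, hxp⟩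

theorem subLogTarget_of_im_eq_zero {ξ : ℂ} (hξ : ‖ξ‖ < Real.sqrt 2) (hi : ξ.im = 0) :
    ∃ p : ℝ, 1 ≤ p ∧ subLogTarget ξ = p := by
  have h0 := re_one_sub_sq_div_two_pos hξ
  have h1 := one_sub_sq_div_two_re ξ
  have hreal : 1 - ξ ^ 2 / 2 = (((1 - ξ ^ 2 / 2).re : ℝ) : ℂ) := by
    apply Complex.ext
    · simp
    · rw [one_sub_sq_div_two_im, hi]
      simp
  refine ⟨1 - Real.log (1 - ξ ^ 2 / 2).re, ?_, ?_⟩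
  · have := Real.log_nonpos h0.le (by rw [h1, hi]; nlinarith [sq_nonneg ξ.re])
    linarith
  · rw [subLogTarget, hreal, ← ofReal_log h0.le]
    push_cast
    simp

theorem IsNegLambertB.conj {ξ v : ℂ} (hξ : ‖ξ‖ < Real.sqrt 2) (h : IsNegLambertB ξ v) :
    IsNegLambertB ((starRingEnd ℂ) ξ) ((starRingEnd ℂ) v) where
  re_pos := by simpa using h.re_pos
  eq := by rw [subLog_conj h.re_pos, subLogTarget_conj hξ, h.eq]
  im_neg h1 := by simpa using h.im_pos (by simpa using h1)
  im_pos h1 := by simpa using h.im_neg (by simpa using h1)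
  le_one h1 h2 := by simpa using h.le_one (by simpa using h1) (by simpa using h2)
  one_le h1 h2 := by simpa using h.one_le (by simpa using h1) (by simpa using h2)

theorem exists_isNegLambertB {ξ : ℂ} (hξ : ‖ξ‖ < Real.sqrt 2) : ∃ v, IsNegLambertB ξ v := by
  have key : ∀ ξ : ℂ, ‖ξ‖ < Real.sqrt 2 → ξ.im < 0 → ∃ v, IsNegLambertB ξ v := by
    intro ξ hξ hi
    obtain ⟨v, h1, h2, h3⟩ := exists_solution_of_im_neg hξ hi
    exact ⟨v, h1, h3, fun h => by linarith, fun _ => h2, fun h => by linarith,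
      fun h => by linarith⟩
  rcases lt_trichotomy ξ.im 0 with h1 | h1 | h1
  · exact key ξ hξ h1
  · obtain ⟨p, hp, hpξ⟩ := subLogTarget_of_im_eq_zero hξ h1
    obtain ⟨⟨x, hx0, hx1, hx⟩, y, hy1, hy⟩ := exists_real_solution hp
    have hsub : ∀ x : ℝ, 0 < x → x - Real.log x = p → subLog x = subLogTarget ξ := by
      intro x hx0 hx
      rw [hpξ, subLog, ← ofReal_log hx0.le, ← ofReal_sub, hx]
    rcases le_or_gt 0 ξ.re with h2 | h2
    · exact ⟨x, hx0, hsub x hx0 hx, fun h => by linarith, fun h => by linarith, fun _ _ => hx1,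
        fun _ h => by linarith⟩
    · have hy0 : 0 < y := by linarith
      exact ⟨y, hy0, hsub y hy0 hy, fun h => by linarith, fun h => by linarith,
        fun _ h => by linarith, fun _ _ => hy1⟩
  · have hc : ‖(starRingEnd ℂ) ξ‖ < Real.sqrt 2 := by simpa using hξ
    obtain ⟨v, hv⟩ := key _ hc (by simpa using h1)
    exact ⟨_, by simpa using hv.conj hc⟩

/-! ### Continuity and analyticity of the solution -/

open Filter Topology in
theorem continuousAt_of_isNegLambertB {g : ℂ → ℂ}
    (hg : ∀ ξ : ℂ, ‖ξ‖ < Real.sqrt 2 → IsNegLambertB ξ (g ξ)) {ξ : ℂ} (hξ : ‖ξ‖ < Real.sqrt 2) :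
    ContinuousAt g ξ := by
  rw [ContinuousAt, tendsto_iff_ultrafilter]
  intro U hU
  have hx : Tendsto id (U : Filter ℂ) (𝓝 ξ) := hU
  have hev : ∀ᶠ y in (U : Filter ℂ), ‖y‖ < Real.sqrt 2 := hx.norm.eventually (gt_mem_nhds hξ)
  obtain ⟨w, hw, hw1, hw2⟩ := exists_ultrafilter_limit_of_subLog_eq U (x := id) (v := g) hξ hx
    (by filter_upwards [hev] with y hy using ⟨(hg y hy).re_pos, (hg y hy).eq⟩)
  have hsol : IsNegLambertB ξ w := IsNegLambertB.of_tendsto hξ hx hw hw1 hw2 hev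
    (by filter_upwards [hev] with y hy using hg y hy)
  rwa [← hsol.unique hξ (hg ξ hξ)]

open Filter Topology in
theorem differentiableOn_of_isNegLambertB {g : ℂ → ℂ}
    (hg : ∀ ξ : ℂ, ‖ξ‖ < Real.sqrt 2 → IsNegLambertB ξ (g ξ)) :
    DifferentiableOn ℂ g (Metric.ball 0 (Real.sqrt 2)) := by
  have hball : Metric.ball (0 : ℂ) (Real.sqrt 2) ∈ 𝓝 0 := Metric.ball_mem_nhds 0 (by positivity)
  -- At `ξ = 0` the derivative `1 - 1/v` vanishes, so that point is treated as a removable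
  -- singularity.
  rw [← differentiableOn_compl_singleton_and_continuousAt_iff hball]
  refine ⟨fun ξ hξ => ?_, continuousAt_of_isNegLambertB hg (by simp)⟩
  have hξ' : ‖ξ‖ < Real.sqrt 2 := mem_ball_zero_iff.1 hξ.1
  have hsol := hg ξ hξ'
  have hcont := continuousAt_of_isNegLambertB hg hξ'
  have hder : (1 - (g ξ)⁻¹ : ℂ) ≠ 0 := by
    intro h0
    have h1 : g ξ = 1 := by
      rw [sub_eq_zero, eq_comm, inv_eq_one] at h0
      exact h0
    have h2 := mul_exp_eq_of_subLog_eq hξ' hsol.re_pos hsol.eq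
    rw [h1] at h2
    have h3 : ξ ^ 2 = 0 := by
      rw [sub_self, exp_zero, one_mul] at h2
      linear_combination 2 * h2
    exact hξ.2 (by simpa using h3)
  have hstrict := hasStrictDerivAt_subLog (v := g ξ) (Or.inl hsol.re_pos)
  have hinv := hcont.eventually (hstrict.eventually_left_inverse hder)
  have hd : DifferentiableAt ℂ subLogTarget ξ := by
    have h : 1 - ξ ^ 2 / 2 ∈ slitPlane := Or.inl (re_one_sub_sq_div_two_pos hξ')
    exact (differentiableAt_const 1).sub (DifferentiableAt.clog (by fun_prop) h)
  have hloc := (hstrict.to_localInverse hder).hasDerivAt.differentiableAt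
  rw [hsol.eq] at hloc
  apply DifferentiableAt.differentiableWithinAt
  refine (hloc.comp ξ hd).congr_of_eventuallyEq ?_
  filter_upwards [hinv, Metric.isOpen_ball.mem_nhds hξ.1] with y hy hy2
  rw [Function.comp_apply, ← (hg y (mem_ball_zero_iff.1 hy2)).eq, hy]

/-! ### Comparison with the branches of the Lambert function -/

theorem puiseuxBranch_eq_zero {ξ : ℂ} (h : 0 < ξ.re ∨ ξ.re = 0 ∧ 0 ≤ ξ.im) :
    puiseuxBranch ξ = 0 := by
  rw [puiseuxBranch, if_pos]
  rw [neg_pi_div_two_lt_arg_iff, arg_le_pi_div_two_iff]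
  grind

theorem puiseuxBranch_eq_one {ξ : ℂ} (h : ξ.re < 0) (h' : 0 < ξ.im) : puiseuxBranch ξ = 1 := by
  rw [puiseuxBranch, if_neg, if_pos]
  · rw [← not_le, arg_le_pi_div_two_iff, arg_lt_pi_iff]
    grind
  · rw [neg_pi_div_two_lt_arg_iff, arg_le_pi_div_two_iff]
    grind

theorem puiseuxBranch_eq_neg_one {ξ : ℂ} (h : ξ.re < 0 ∧ ξ.im ≤ 0 ∨ ξ.re = 0 ∧ ξ.im < 0) :
    puiseuxBranch ξ = -1 := by
  rw [puiseuxBranch, if_neg, if_neg]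
  · rw [← not_le, arg_le_pi_div_two_iff, arg_lt_pi_iff]
    grind
  · rw [neg_pi_div_two_lt_arg_iff, arg_le_pi_div_two_iff]
    grind

theorem mem_lambertRange_zero {w : ℂ} : w ∈ lambertRange 0 ↔
    w ∈ lambertBelow 0 ∧ w ∈ lambertAbove 0 ∧ (w.im = 0 → -1 ≤ w.re) := Iff.rfl

theorem mem_lambertRange_one {w : ℂ} : w ∈ lambertRange 1 ↔
    w ∈ lambertBelow 1 ∧ w ∉ lambertBelow 0 := Iff.rfl

theorem mem_lambertRange_neg_one {w : ℂ} : w ∈ lambertRange (-1) ↔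
    (w ∈ lambertAbove 1 ∧ w ∉ lambertAbove 0) ∨ (w.im = 0 ∧ w.re ≤ -1) := Iff.rfl

theorem mem_lambertBelow_zero {w : ℂ} : w ∈ lambertBelow 0 ↔
    w.im ≤ 0 ∨ (0 < w.im ∧ w.im < Real.pi ∧ -w.im * Real.cot w.im ≤ w.re) := by
  simp [lambertBelow]

theorem mem_lambertBelow_one {w : ℂ} : w ∈ lambertBelow 1 ↔ w.im ≤ 2 * Real.pi ∨
    (2 * Real.pi < w.im ∧ w.im < 3 * Real.pi ∧ -w.im * Real.cot w.im ≤ w.re) := by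
  simp [lambertBelow, show (2 + 1 : ℝ) = 3 by norm_num]

theorem mem_lambertAbove_zero {w : ℂ} : w ∈ lambertAbove 0 ↔
    0 ≤ w.im ∨ (-Real.pi < w.im ∧ w.im < 0 ∧ -w.im * Real.cot w.im < w.re) := by
  simp [lambertAbove]

theorem mem_lambertAbove_one {w : ℂ} : w ∈ lambertAbove 1 ↔ -(2 * Real.pi) ≤ w.im ∨
    (-(3 * Real.pi) < w.im ∧ w.im < -(2 * Real.pi) ∧ -w.im * Real.cot w.im < w.re) := by
  simp [lambertAbove, show (2 + 1 : ℝ) = 3 by norm_num]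

theorem mul_exp_eq_iff {ξ w : ℂ} : w * exp w = (ξ ^ 2 - 2) / (2 * exp 1) ↔
    -w * exp (1 - -w) = 1 - ξ ^ 2 / 2 := by
  have h : exp 1 ≠ 0 := exp_ne_zero 1
  rw [sub_neg_eq_add, exp_add, eq_div_iff (mul_ne_zero two_ne_zero h)]
  constructor <;> intro h1
  · linear_combination -h1 / 2
  · linear_combination -2 * h1

theorem mul_exp_im {ξ w : ℂ} (h : -w * exp (1 - -w) = 1 - ξ ^ 2 / 2) :
    Real.exp (1 + w.re) * (w.re * Real.sin w.im + w.im * Real.cos w.im) = ξ.re * ξ.im := by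
  have h1 := mul_exp_one_sub_im (-w)
  rw [h, one_sub_sq_div_two_im, neg_im, neg_re, Real.cos_neg, Real.sin_neg, sub_neg_eq_add] at h1
  linear_combination h1

/-- On the boundary curves `w e^w` is real, so the side of the curve is read off from the sign of
`Im (w e^w)`, a positive multiple of `Re ξ · Im ξ`. -/
theorem neg_mul_cot_le_iff {ξ w : ℂ} (h : -w * exp (1 - -w) = 1 - ξ ^ 2 / 2)
    (hs : 0 < Real.sin w.im) : -w.im * Real.cot w.im ≤ w.re ↔ 0 ≤ ξ.re * ξ.im := by
  rw [← mul_exp_im h, mul_nonneg_iff_of_pos_left (Real.exp_pos _), Real.cot_eq_cos_div_sin,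
    ← mul_div_assoc, div_le_iff₀ hs]
  constructor <;> intro h1 <;> linarith

theorem neg_mul_cot_lt_iff {ξ w : ℂ} (h : -w * exp (1 - -w) = 1 - ξ ^ 2 / 2)
    (hs : Real.sin w.im < 0) : -w.im * Real.cot w.im < w.re ↔ ξ.re * ξ.im < 0 := by
  rw [← mul_exp_im h, ← not_le (b := Real.exp _ * _), mul_nonneg_iff_of_pos_left (Real.exp_pos _), not_le,
    Real.cot_eq_cos_div_sin,
    ← mul_div_assoc, div_lt_iff_of_neg hs]
  constructor <;> intro h1 <;> linarith

theorem exists_int_subLog_eq {ξ v : ℂ} (hξ : ‖ξ‖ < Real.sqrt 2) (hv : 0 < v.re)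
    (h : v * exp (1 - v) = 1 - ξ ^ 2 / 2) :
    ∃ m : ℤ, subLog v = subLogTarget ξ + m * (2 * Real.pi * I) ∧
      v.im - arg v + arg (1 - ξ ^ 2 / 2) = m * (2 * Real.pi) := by
  have hq := re_one_sub_sq_div_two_pos hξ
  have h1 : exp (subLog v) = exp (subLogTarget ξ) := by
    have hv0 := Complex.ne_zero_of_re_pos hv
    rw [subLog, subLogTarget, exp_sub, exp_sub, exp_log hv0,
      exp_log (Complex.ne_zero_of_re_pos hq), ← h, exp_sub]
    have := exp_ne_zero v
    have := exp_ne_zero 1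
    field_simp
  obtain ⟨m, hm⟩ := exp_eq_exp_iff_exists_int.1 h1
  refine ⟨m, hm, ?_⟩
  have h2 := congrArg im hm
  rw [add_im, subLog_im, subLogTarget_im] at h2
  simp at h2
  linarith

/-- The ambiguity `2πm` is less than `π + π/2 + π/2` in absolute value, so `m = 0`. -/
theorem subLog_eq_of_abs_im_lt_pi {ξ v : ℂ} (hξ : ‖ξ‖ < Real.sqrt 2) (hv : 0 < v.re)
    (h : v * exp (1 - v) = 1 - ξ ^ 2 / 2) (hi : |v.im| < Real.pi) :
    subLog v = subLogTarget ξ := by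
  obtain ⟨m, hm, hm2⟩ := exists_int_subLog_eq hξ hv h
  have h1 := abs_lt.1 (abs_arg_lt_of_re_pos hv)
  have h2 := abs_lt.1 (abs_arg_lt_of_re_pos (re_one_sub_sq_div_two_pos hξ))
  have h3 := abs_lt.1 hi
  have hpi := Real.pi_pos
  have h4 : (-1 : ℝ) < m := by nlinarith
  have h5 : (m : ℝ) < 1 := by nlinarith
  have h6 : m = 0 := by
    have : -1 < m := by exact_mod_cast h4
    have : m < 1 := by exact_mod_cast h5
    omega
  rw [hm, h6]
  simp

theorem isNegLambertB_of_mem_lambertRange {ξ w : ℂ} (hξ : ‖ξ‖ < Real.sqrt 2)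
    (hw : w ∈ lambertRange (puiseuxBranch ξ)) (h : w * exp w = (ξ ^ 2 - 2) / (2 * exp 1)) :
    IsNegLambertB ξ (-w) := by
  have hpi := Real.pi_pos
  have heq := mul_exp_eq_iff.1 h
  have hre : 0 < (-w).re := re_pos_of_mul_exp_eq (by simpa using norm_sq_div_two_lt_one hξ) heq
  have hq := re_one_sub_sq_div_two_pos hξ
  have ha := abs_lt.1 (abs_arg_lt_of_re_pos hre)
  have haq := abs_lt.1 (abs_arg_lt_of_re_pos hq)
  have hneg_im : (-w).im = -w.im := neg_im w
  have hfin : |w.im| < Real.pi → (ξ.im ≠ 0 → 0 < w.im * ξ.im) →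
      (ξ.im = 0 → w.im = 0 → 0 ≤ ξ.re → -1 ≤ w.re) →
      (ξ.im = 0 → w.im = 0 → ξ.re < 0 → w.re ≤ -1) → IsNegLambertB ξ (-w) := by
    intro h1 h2 h3 h4
    have hsub := subLog_eq_of_abs_im_lt_pi hξ hre heq (by rwa [hneg_im, abs_neg])
    refine ⟨hre, hsub, fun h5 => ?_, fun h5 => ?_, fun h5 h6 => ?_, fun h5 h6 => ?_⟩
    · have := pos_of_mul_pos_left (h2 h5.ne') h5.le
      linarith
    · have := neg_of_mul_pos_left (h2 h5.ne) h5.le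
      linarith
    · have := h3 h5 (by simpa using solution_im_eq_zero hξ hre hsub h5) h6
      rw [neg_re]
      linarith
    · have := h4 h5 (by simpa using solution_im_eq_zero hξ hre hsub h5) h6
      rw [neg_re]
      linarith
  have hne : ξ.im ≠ 0 → w.im ≠ 0 := fun h1 h2 => h1 (im_eq_zero_of_solution_im_eq_zero hξ hre
    (subLog_eq_of_abs_im_lt_pi hξ hre heq (by simpa [h2] using hpi)) (by simpa using h2))
  have hm := exists_int_subLog_eq hξ hre heq
  have hno_int : ∀ m : ℤ, ∀ t : ℝ, t = m * (2 * Real.pi) → 0 < t → t < 2 * Real.pi → False := by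
    intro m t ht h1 h2
    have h3 : (0 : ℝ) < m := by nlinarith
    have h4 : (m : ℝ) < 1 := by nlinarith
    have h5 : 0 < m := by exact_mod_cast h3
    have h6 : m < 1 := by exact_mod_cast h4
    omega
  by_cases hA : 0 < ξ.re ∨ ξ.re = 0 ∧ 0 ≤ ξ.im
  · rw [puiseuxBranch_eq_zero hA, mem_lambertRange_zero, mem_lambertBelow_zero,
      mem_lambertAbove_zero] at hw
    obtain ⟨hb, hab, h0⟩ := hw
    refine hfin ?_ ?_ (fun _ h1 _ => h0 h1) (fun _ _ h1 => by grind)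
    · rw [abs_lt]
      constructor
      · rcases hab with h1 | h1 <;> linarith
      · rcases hb with h1 | h1 <;> linarith
    · intro h1
      rcases lt_or_gt_of_ne (hne h1) with h2 | h2
      · obtain ⟨h3, -, h4⟩ := hab.resolve_left (not_le.2 h2)
        rw [neg_mul_cot_lt_iff heq (Real.sin_neg_of_neg_of_neg_pi_lt h2 h3)] at h4
        have h5 : 0 ≤ ξ.re := by grind
        have h6 : ξ.im < 0 := by
          by_contra h7
          nlinarith
        exact mul_pos_of_neg_of_neg h2 h6
      · obtain ⟨-, h3, h4⟩ := hb.resolve_left (not_le.2 h2)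
        rw [neg_mul_cot_le_iff heq (Real.sin_pos_of_pos_of_lt_pi h2 h3)] at h4
        have h6 : 0 < ξ.im := by
          rcases hA with h7 | h7
          · exact lt_of_le_of_ne (nonneg_of_mul_nonneg_right h4 h7) h1.symm
          · exact lt_of_le_of_ne h7.2 h1.symm
        exact mul_pos h2 h6
  by_cases hB : ξ.re < 0 ∧ 0 < ξ.im
  · have hP : ξ.re * ξ.im < 0 := mul_neg_of_neg_of_pos hB.1 hB.2
    rw [puiseuxBranch_eq_one hB.1 hB.2, mem_lambertRange_one, mem_lambertBelow_one,
      mem_lambertBelow_zero] at hw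
    obtain ⟨hb, hab⟩ := hw
    have hy : 0 < w.im := by
      by_contra h1
      exact hab (Or.inl (not_lt.1 h1))
    rcases lt_or_ge w.im Real.pi with h1 | h1
    · exact hfin (abs_lt.2 ⟨by linarith, h1⟩) (fun _ => mul_pos hy hB.2)
        (fun h2 => absurd h2 hB.2.ne') (fun h2 => absurd h2 hB.2.ne')
    -- The range of `W_1` reaches above `Im w = π`. For `π ≤ Im w ≤ 2π` the arguments would differ
    -- by a multiple of `2π` strictly between `-2π` and `0`; above `2π`, the side of the curve
    -- contradicts the quadrant of `ξ`.
    · exfalso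
      rcases hb with h2 | ⟨h2, h3, h4⟩
      · obtain ⟨m, -, hm⟩ := hm
        have h3 : arg (-w) < 0 := arg_neg_iff.2 (by linarith)
        have h4 : 0 < arg (1 - ξ ^ 2 / 2) := by
          refine lt_of_le_of_ne (arg_nonneg_iff.2 ?_) fun h0 => ?_
          · rw [one_sub_sq_div_two_im]
            linarith
          · have := (arg_eq_zero_iff.1 h0.symm).2
            rw [one_sub_sq_div_two_im] at this
            linarith
        refine hno_int (-m) _ ?_ (?_ : 0 < -((-w).im - arg (-w) + arg (1 - ξ ^ 2 / 2))) ?_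
        · push_cast
          linarith
        · linarith
        · linarith
      · have hs : 0 < Real.sin w.im := by
          rw [← Real.sin_sub_two_pi]
          exact Real.sin_pos_of_pos_of_lt_pi (by linarith) (by linarith)
        rw [neg_mul_cot_le_iff heq hs] at h4
        linarith
  · have hC : ξ.re < 0 ∧ ξ.im ≤ 0 ∨ ξ.re = 0 ∧ ξ.im < 0 := by grind
    have hP : 0 ≤ ξ.re * ξ.im := by
      rcases hC with h1 | h1
      · exact mul_nonneg_of_nonpos_of_nonpos h1.1.le h1.2
      · rw [h1.1, zero_mul]
    have hi : ξ.im ≤ 0 := by grind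
    rw [puiseuxBranch_eq_neg_one hC, mem_lambertRange_neg_one, mem_lambertAbove_one,
      mem_lambertAbove_zero] at hw
    rcases hw with ⟨hb, hab⟩ | ⟨h1, h2⟩
    · have hy : w.im < 0 := by
        by_contra h1
        exact hab (Or.inl (not_lt.1 h1))
      rcases lt_or_ge (-Real.pi) w.im with h1 | h1
      · exact hfin (abs_lt.2 ⟨h1, by linarith⟩)
          (fun h2 => mul_pos_of_neg_of_neg hy (lt_of_le_of_ne hi h2))
          (fun _ h2 => absurd h2 hy.ne) (fun _ h2 => absurd h2 hy.ne)
      · exfalso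
        rcases hb with h2 | ⟨h2, h3, h4⟩
        · obtain ⟨m, -, hm⟩ := hm
          have h3 : 0 ≤ arg (-w) := arg_nonneg_iff.2 (by linarith)
          have h4 : arg (1 - ξ ^ 2 / 2) ≤ 0 := by
            rcases hP.eq_or_lt with h5 | h5
            · have hreal : 1 - ξ ^ 2 / 2 = (((1 - ξ ^ 2 / 2).re : ℝ) : ℂ) := by
                apply Complex.ext
                · simp
                · rw [one_sub_sq_div_two_im, ← h5]
                  simp
              rw [hreal, arg_ofReal_of_nonneg hq.le]
            · exact (arg_neg_iff.2 (by rw [one_sub_sq_div_two_im]; linarith)).le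
          have h5 : 0 < arg (-w) := by
            refine lt_of_le_of_ne h3 fun h0 => ?_
            have := (arg_eq_zero_iff.1 h0.symm).2
            linarith
          exact hno_int m _ hm (by linarith) (by linarith)
        · have hs : Real.sin w.im < 0 := by
            rw [← Real.sin_add_two_pi]
            exact Real.sin_neg_of_neg_of_neg_pi_lt (by linarith) (by linarith)
          rw [neg_mul_cot_lt_iff heq hs] at h4
          linarith
    · exact hfin (by simpa [h1] using hpi) (fun h3 => absurd h1 (hne h3))
        (fun h3 _ h4 => by grind) (fun _ _ _ => h2)

theorem IsNegLambertB.neg_mem_lambertRange {ξ v : ℂ} (hξ : ‖ξ‖ < Real.sqrt 2)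
    (hv : IsNegLambertB ξ v) : -v ∈ lambertRange (puiseuxBranch ξ) := by
  have hpi := Real.pi_pos
  have heq : - -v * exp (1 - - -v) = 1 - ξ ^ 2 / 2 := by
    rw [neg_neg]
    exact mul_exp_eq_of_subLog_eq hξ hv.re_pos hv.eq
  have ha := abs_lt.1 (abs_arg_lt_of_re_pos hv.re_pos)
  have haq := abs_lt.1 (abs_arg_lt_of_re_pos (re_one_sub_sq_div_two_pos hξ))
  have him := congrArg im hv.eq
  rw [subLog_im, subLogTarget_im] at him
  obtain ⟨hb1, hb2⟩ : -Real.pi < (-v).im ∧ (-v).im < Real.pi := by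
    rw [neg_im]
    constructor <;> linarith
  have hpos : 0 < ξ.im → 0 < (-v).im := fun h => by simpa using hv.im_neg h
  have hneg : ξ.im < 0 → (-v).im < 0 := fun h => by simpa using hv.im_pos h
  have hzero : ξ.im = 0 → (-v).im = 0 := fun h => by
    simpa using solution_im_eq_zero hξ hv.re_pos hv.eq h
  have hbelow : 0 < (-v).im → (-(-v).im * Real.cot (-v).im ≤ (-v).re ↔ 0 ≤ ξ.re * ξ.im) :=
    fun h => neg_mul_cot_le_iff heq (Real.sin_pos_of_pos_of_lt_pi h hb2)
  have habove : (-v).im < 0 → (-(-v).im * Real.cot (-v).im < (-v).re ↔ ξ.re * ξ.im < 0) :=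
    fun h => neg_mul_cot_lt_iff heq (Real.sin_neg_of_neg_of_neg_pi_lt h hb1)
  have hle : ξ.im = 0 → 0 ≤ ξ.re → -1 ≤ (-v).re := fun h h' => by simpa using hv.le_one h h'
  have hge : ξ.im = 0 → ξ.re < 0 → (-v).re ≤ -1 := fun h h' => by simpa using hv.one_le h h'
  by_cases hA : 0 < ξ.re ∨ ξ.re = 0 ∧ 0 ≤ ξ.im
  · rw [puiseuxBranch_eq_zero hA, mem_lambertRange_zero, mem_lambertBelow_zero,
      mem_lambertAbove_zero]
    rcases lt_trichotomy ξ.im 0 with h1 | h1 | h1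
    · have h2 := hneg h1
      have h3 : 0 < ξ.re := by grind
      exact ⟨Or.inl h2.le, Or.inr ⟨hb1, h2, (habove h2).2 (mul_neg_of_pos_of_neg h3 h1)⟩,
        fun h => absurd h h2.ne⟩
    · have h2 := hzero h1
      exact ⟨Or.inl h2.le, Or.inl h2.ge, fun _ => hle h1 (by grind)⟩
    · have h2 := hpos h1
      exact ⟨Or.inr ⟨h2, hb2, (hbelow h2).2 (mul_nonneg (by grind) h1.le)⟩, Or.inl h2.le,
        fun h => absurd h h2.ne'⟩
  by_cases hB : ξ.re < 0 ∧ 0 < ξ.im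
  · rw [puiseuxBranch_eq_one hB.1 hB.2, mem_lambertRange_one, mem_lambertBelow_one,
      mem_lambertBelow_zero]
    have h2 := hpos hB.2
    refine ⟨Or.inl (by linarith), ?_⟩
    rintro (h3 | ⟨-, -, h3⟩)
    · linarith
    · have := (hbelow h2).1 h3
      nlinarith [mul_neg_of_neg_of_pos hB.1 hB.2]
  · have hC : ξ.re < 0 ∧ ξ.im ≤ 0 ∨ ξ.re = 0 ∧ ξ.im < 0 := by grind
    rw [puiseuxBranch_eq_neg_one hC, mem_lambertRange_neg_one, mem_lambertAbove_one,
      mem_lambertAbove_zero]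
    have hi : ξ.im ≤ 0 := by grind
    rcases hi.eq_or_lt with h1 | h1
    · exact Or.inr ⟨hzero h1, hge h1 (by grind)⟩
    · have h2 := hneg h1
      refine Or.inl ⟨Or.inl (by linarith), ?_⟩
      rintro (h3 | ⟨-, -, h3⟩)
      · linarith
      · have h4 := (habove h2).1 h3
        have h5 : ξ.re ≤ 0 := by grind
        nlinarith [mul_nonneg_of_nonpos_of_nonpos h5 hi]

theorem isNegLambertB_neg_lambertB {ξ : ℂ} (hξ : ‖ξ‖ < Real.sqrt 2) :
    IsNegLambertB ξ (-lambertB ξ) := by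
  obtain ⟨v, hv⟩ := exists_isNegLambertB hξ
  -- `Function.invFunOn` returns a genuine preimage only once one is known to exist in the range.
  have hex : ∃ w ∈ lambertRange (puiseuxBranch ξ), w * exp w = (ξ ^ 2 - 2) / (2 * exp 1) :=
    ⟨-v, hv.neg_mem_lambertRange hξ, mul_exp_eq_iff.2 (by
      rw [neg_neg]
      exact mul_exp_eq_of_subLog_eq hξ hv.re_pos hv.eq)⟩
  exact isNegLambertB_of_mem_lambertRange hξ (Function.invFunOn_mem hex)
    (Function.invFunOn_eq hex)

/-! ### The function `B` on the disk -/

theorem differentiableOn_lambertB :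
    DifferentiableOn ℂ lambertB (Metric.ball 0 (Real.sqrt 2)) := by
  have h := (differentiableOn_of_isNegLambertB (g := fun ξ => -lambertB ξ)
    fun ξ hξ => isNegLambertB_neg_lambertB hξ).neg
  simpa only [Pi.neg_def, neg_neg] using h

theorem lambertB_re_neg {ξ : ℂ} (hξ : ‖ξ‖ < Real.sqrt 2) : (lambertB ξ).re < 0 := by
  simpa using (isNegLambertB_neg_lambertB hξ).re_pos

theorem lambertB_zero : lambertB 0 = -1 := by
  have h0 : ‖(0 : ℂ)‖ < Real.sqrt 2 := by simp
  rw [← (isNegLambertB_neg_lambertB h0).unique h0 isNegLambertB_zero_one, neg_neg]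

open Filter Topology in
-- Differentiating `B e^{1+B} = ξ²/2 - 1` gives `(1+B) e^{1+B} B' = ξ`; differentiating again at
-- `0`, where `1 + B = 0`, leaves `B'(0)² = 1`.
theorem deriv_lambertB_zero_sq : deriv lambertB 0 ^ 2 = 1 := by
  have hball : Metric.ball (0 : ℂ) (Real.sqrt 2) ∈ 𝓝 0 := Metric.ball_mem_nhds 0 (by positivity)
  have heq : ∀ ξ ∈ Metric.ball (0 : ℂ) (Real.sqrt 2),
      lambertB ξ * exp (1 + lambertB ξ) = ξ ^ 2 / 2 - 1 := by
    intro ξ hξ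
    rw [mem_ball_zero_iff] at hξ
    have hs := isNegLambertB_neg_lambertB hξ
    have h := mul_exp_eq_of_subLog_eq hξ hs.re_pos hs.eq
    rw [sub_neg_eq_add] at h
    linear_combination -h
  have hder : ∀ ξ ∈ Metric.ball (0 : ℂ) (Real.sqrt 2),
      (1 + lambertB ξ) * (exp (1 + lambertB ξ) * deriv lambertB ξ) = ξ := by
    intro ξ hξ
    have hmem := Metric.isOpen_ball.mem_nhds hξ
    have hd := (differentiableOn_lambertB.differentiableAt hmem).hasDerivAt
    have h1 := hd.mul ((hd.const_add 1).cexp)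
    have h2 : HasDerivAt (fun ξ : ℂ => ξ ^ 2 / 2 - 1) ξ ξ := by
      have := ((hasDerivAt_pow 2 ξ).div_const 2).sub_const 1
      simpa using this
    have h3 := h1.unique (h2.congr_of_eventuallyEq (by
      filter_upwards [hmem] with y hy using heq y hy))
    linear_combination h3
  have h0 : (0 : ℂ) ∈ Metric.ball (0 : ℂ) (Real.sqrt 2) := mem_of_mem_nhds hball
  have hd := (differentiableOn_lambertB.differentiableAt hball).hasDerivAt
  have hd2 := ((differentiableOn_lambertB.deriv Metric.isOpen_ball).differentiableAt
    hball).hasDerivAt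
  have h1 := (hd.const_add 1).mul (((hd.const_add 1).cexp).mul hd2)
  have h2 := h1.unique ((hasDerivAt_id (0 : ℂ)).congr_of_eventuallyEq (by
    filter_upwards [hball] with y hy using hder y hy))
  simp only [lambertB_zero, Pi.mul_apply] at h2
  simp at h2
  rw [pow_two, h2]

/-! ### Coefficient bounds -/

/-- Cauchy's formula for Taylor coefficients, as a circle average. -/
theorem circleAverage_mul_inv_pow {f : ℂ → ℂ} {r : ℝ} (hr : 0 < r)
    (hf : DiffContOnCl ℂ f (Metric.ball 0 r)) (n : ℕ) :
    Real.circleAverage (fun z => f z * (z ^ n)⁻¹) 0 r = iteratedDeriv n f 0 / n.factorial := by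
  rw [Real.circleAverage_eq_circleIntegral hr.ne']
  have h := hf.circleIntegral_one_div_sub_center_pow_smul hr n
  have h2 : (∮ z in C(0, r), (z - 0)⁻¹ • (f z * (z ^ n)⁻¹)) =
      ∮ z in C(0, r), (1 / (z - 0) ^ (n + 1)) • f z := by
    congr 1
    ext z
    simp only [sub_zero, smul_eq_mul, pow_succ, one_div, mul_inv]
    ring
  rw [h2, h, smul_smul, smul_eq_mul, div_eq_mul_inv, ← mul_assoc,
    inv_mul_cancel₀ two_pi_I_ne_zero, one_mul, mul_comm, div_eq_mul_inv]

/-- Carathéodory's bound for the Taylor coefficients of a function with negative real part,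
on a circle. -/
theorem norm_iteratedDeriv_le_of_re_nonpos_of_diffContOnCl {f : ℂ → ℂ} {r : ℝ} (hr : 0 < r)
    (hf : DiffContOnCl ℂ f (Metric.ball 0 r)) (hre : ∀ z ∈ Metric.sphere (0 : ℂ) r, (f z).re ≤ 0)
    {n : ℕ} (hn : n ≠ 0) :
    ‖iteratedDeriv n f 0 / n.factorial‖ ≤ 2 * (-(f 0).re) / r ^ n := by
  have habs : |r| = r := abs_of_pos hr
  have hcl : ContinuousOn f (Metric.sphere 0 |r|) := by
    rw [habs]
    exact hf.continuousOn_ball.mono Metric.sphere_subset_closedBall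
  have hinv : ContinuousOn (fun z : ℂ => (z ^ n)⁻¹) (Metric.sphere 0 |r|) := by
    apply ContinuousOn.inv₀ (by fun_prop)
    intro z hz
    rw [habs] at hz
    exact pow_ne_zero n (Metric.ne_of_mem_sphere hz hr.ne')
  have hpow : ContinuousOn (fun z : ℂ => z ^ n) (Metric.sphere 0 |r|) := by fun_prop
  have hmean : Real.circleAverage (fun z => f z * z ^ n) 0 r = 0 := by
    have h1 : DiffContOnCl ℂ (fun z => f z * z ^ n) (Metric.ball 0 |r|) := by
      rw [habs]
      exact hf.smul (Differentiable.diffContOnCl (by fun_prop : Differentiable ℂ fun z : ℂ => z ^ n))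
    rw [DiffContOnCl.circleAverage h1]
    simp [hn]
  have hconj : Real.circleAverage (fun z => (starRingEnd ℂ) (f z * z ^ n)) 0 r = 0 := by
    have h1 := ContinuousLinearMap.circleAverage_comp_comm
      (conjCLE.toContinuousLinearMap : ℂ →L[ℝ] ℂ) (hcl.mul hpow).circleIntegrable'
    rw [show (fun z => f z * z ^ n) = f * fun z => z ^ n from rfl] at hmean
    rw [hmean, map_zero] at h1
    exact h1
  -- On the circle `z⁻ⁿ = r^{-2n} conj (zⁿ)`, so adding the vanishing average of `conj (f zⁿ)`
  -- replaces `f` by `2 Re f`, which has constant sign.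
  have hsum : iteratedDeriv n f 0 / n.factorial =
      Real.circleAverage (fun z => ((2 * (f z).re : ℝ) : ℂ) * (z ^ n)⁻¹) 0 r := by
    rw [← circleAverage_mul_inv_pow hr hf n]
    have h1 : Real.circleAverage (fun z => ((2 * (f z).re : ℝ) : ℂ) * (z ^ n)⁻¹) 0 r =
        Real.circleAverage (fun z => f z * (z ^ n)⁻¹ +
          (((r ^ 2) ^ n)⁻¹ : ℂ) • (starRingEnd ℂ) (f z * z ^ n)) 0 r := by
      apply Real.circleAverage_congr_sphere
      intro z hz
      rw [habs, mem_sphere_zero_iff_norm] at hz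
      have hz0 : z ≠ 0 := norm_pos_iff.1 (by rw [hz]; exact hr)
      have hzz : (r : ℂ) ^ 2 = z * (starRingEnd ℂ) z := by
        rw [mul_conj, normSq_eq_norm_sq, hz, ofReal_pow]
      have hzc : (starRingEnd ℂ) z ≠ 0 := (map_ne_zero _).2 hz0
      have h2 := add_conj (f z)
      simp only [smul_eq_mul, map_mul, map_pow]
      rw [← h2, hzz, mul_pow]
      field_simp
    have hint : CircleIntegrable (fun z => (starRingEnd ℂ) (f z * z ^ n)) 0 r :=
      (continuous_conj.comp_continuousOn (hcl.mul hpow)).circleIntegrable'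
    have hint2 : CircleIntegrable (fun z => f z * (z ^ n)⁻¹) 0 r :=
      (hcl.mul hinv).circleIntegrable'
    rw [h1, Real.circleAverage_fun_add hint2 hint.const_fun_smul, Real.circleAverage_fun_smul, hconj, smul_zero, add_zero]
  have hmeanre : Real.circleAverage (fun z => (f z).re) 0 r = (f 0).re := by
    have h1 := ContinuousLinearMap.circleAverage_comp_comm reCLM hcl.circleIntegrable'
    rw [DiffContOnCl.circleAverage (by rwa [habs])] at h1
    exact h1
  rw [hsum, Real.circleAverage_def, norm_smul, norm_inv, Real.norm_of_nonneg Real.two_pi_pos.le]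
  have hbound : ‖∫ θ in (0 : ℝ)..2 * Real.pi, ((2 * (f (circleMap 0 r θ)).re : ℝ) : ℂ) *
      (circleMap 0 r θ ^ n)⁻¹‖ ≤
      ∫ θ in (0 : ℝ)..2 * Real.pi, (-2 / r ^ n) * (f (circleMap 0 r θ)).re := by
    refine (intervalIntegral.norm_integral_le_integral_norm Real.two_pi_pos.le).trans_eq ?_
    congr 1
    ext θ
    have hle := hre _ (circleMap_mem_sphere 0 hr.le θ)
    rw [norm_mul, norm_real, norm_inv, norm_pow, norm_circleMap_zero, habs,
      Real.norm_of_nonpos (by linarith)]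
    ring
  rw [intervalIntegral.integral_const_mul] at hbound
  rw [Real.circleAverage_def, smul_eq_mul] at hmeanre
  calc (2 * Real.pi)⁻¹ * _ ≤ (2 * Real.pi)⁻¹ * _ :=
        mul_le_mul_of_nonneg_left hbound (by positivity)
    _ = (-2 / r ^ n) * ((2 * Real.pi)⁻¹ *
        ∫ θ in (0 : ℝ)..2 * Real.pi, (f (circleMap 0 r θ)).re) := by ring
    _ = 2 * (-(f 0).re) / r ^ n := by
        rw [hmeanre]
        ring

open Filter Topology in
/-- Carathéodory's bound for the Taylor coefficients of a function with negative real part. -/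
theorem norm_iteratedDeriv_le_of_re_nonpos {f : ℂ → ℂ} {R : ℝ} (hR : 0 < R)
    (hf : DifferentiableOn ℂ f (Metric.ball 0 R)) (hre : ∀ z ∈ Metric.ball (0 : ℂ) R, (f z).re ≤ 0)
    {n : ℕ} (hn : n ≠ 0) :
    ‖iteratedDeriv n f 0 / n.factorial‖ ≤ 2 * (-(f 0).re) / R ^ n := by
  -- `f` need not extend to the circle of radius `R`, so the bound is taken on radii `r < R` and `r`
  -- tends to `R`.
  have hlim : Tendsto (fun r : ℝ => 2 * (-(f 0).re) / r ^ n) (𝓝[<] R)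
      (𝓝 (2 * (-(f 0).re) / R ^ n)) :=
    (tendsto_const_nhds.div (tendsto_id.pow n) (pow_ne_zero n hR.ne')).mono_left
      nhdsWithin_le_nhds
  refine ge_of_tendsto hlim ?_
  filter_upwards [Ioo_mem_nhdsLT hR] with r hr
  have hsub : Metric.closedBall (0 : ℂ) r ⊆ Metric.ball 0 R :=
    Metric.closedBall_subset_ball hr.2
  exact norm_iteratedDeriv_le_of_re_nonpos_of_diffContOnCl hr.1
    ((hf.mono (Metric.closure_ball_subset_closedBall.trans hsub)).diffContOnCl)
    (fun z hz => hre z (hsub (Metric.sphere_subset_closedBall hz))) hn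

theorem norm_puiseuxCoeff_le {n : ℕ} (hn : n ≠ 0) :
    ‖puiseuxCoeff n‖ ≤ 2 / Real.sqrt 2 ^ n := by
  have h := norm_iteratedDeriv_le_of_re_nonpos (by positivity) differentiableOn_lambertB
    (fun z hz => (lambertB_re_neg (mem_ball_zero_iff.1 hz)).le) hn
  simpa [lambertB_zero, puiseuxCoeff] using h

theorem puiseuxCoeff_zero : puiseuxCoeff 0 = -1 := by
  simp [puiseuxCoeff, lambertB_zero]

theorem norm_puiseuxCoeff_one : ‖puiseuxCoeff 1‖ = 1 := by
  have h := congrArg norm deriv_lambertB_zero_sq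
  rw [norm_pow, norm_one] at h
  simpa [puiseuxCoeff, iteratedDeriv_one] using
    (pow_eq_one_iff_of_nonneg (norm_nonneg _) two_ne_zero).1 h

theorem mainTheorem1 :
    (DifferentiableOn ℂ lambertB (Metric.ball 0 (Real.sqrt 2)) ∧
      ∀ ξ : ℂ, ‖ξ‖ < Real.sqrt 2 → HasSum (fun n : ℕ => puiseuxCoeff n * ξ ^ n) (lambertB ξ)) ∧
    (∀ n : ℕ, ‖puiseuxCoeff n‖ < 2 * (4 / 5 : ℝ) ^ n) ∧
    (∀ n : ℕ, ‖puiseuxCoeff n‖ ≤ 1) := by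
  have h2 : (0 : ℝ) < Real.sqrt 2 := by positivity
  have h22 : Real.sqrt 2 ^ 2 = 2 := Real.sq_sqrt (by norm_num)
  refine ⟨⟨differentiableOn_lambertB, fun ξ hξ => ?_⟩, fun n => ?_, fun n => ?_⟩
  · have h := hasSum_taylorSeries_on_ball differentiableOn_lambertB (mem_ball_zero_iff.2 hξ)
    have heq : (fun n : ℕ => puiseuxCoeff n * ξ ^ n) = fun n : ℕ =>
        (n.factorial : ℂ)⁻¹ • (ξ - 0) ^ n • iteratedDeriv n lambertB 0 := by
      ext n
      simp only [puiseuxCoeff, sub_zero, smul_eq_mul]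
      ring
    rw [heq]
    exact h
  · rcases eq_or_ne n 0 with rfl | hn
    · rw [puiseuxCoeff_zero]
      norm_num
    · refine (norm_puiseuxCoeff_le hn).trans_lt ?_
      rw [div_eq_mul_inv, ← inv_pow]
      have h3 : (Real.sqrt 2)⁻¹ < 4 / 5 := by
        rw [inv_lt_comm₀ h2 (by norm_num)]
        nlinarith
      gcongr
  · rcases n with _ | _ | n
    · simp [puiseuxCoeff_zero]
    · exact norm_puiseuxCoeff_one.le
    · refine (norm_puiseuxCoeff_le (by omega)).trans ?_
      -- The index is now `n + 2`, and the factor `√2² = 2` absorbs the constant of Carathéodory's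
      -- bound.
      rw [div_le_one (by positivity), add_assoc, pow_add, one_add_one_eq_two, h22]
      have h3 : 1 ≤ Real.sqrt 2 ^ n := one_le_pow₀ (by nlinarith)
      linarith
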